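/- Let $F:[0,1]\to[0,1]$ be the Farey map, $F(x)=x/(1-x)$ for $0\le x\le \tfrac12$ and $F(x)=(1-x)/x$ for $\tfrac12<x\le 1$, let $F^{-k}[\alpha,\beta]=\{x\in[0,1]: F^k(x)\in[\alpha,\beta]\}$, where $F^k$ is the $k$-fold iterate of $F$, and let $\lambda$ be Lebesgue measure on $[0,1]$. For any interval $[\alpha,\beta]\subseteq(0,1]$ (that is, $0<\alpha\le\beta\le 1$), we have $$\lambda\bigl(F^{-(n-1)}[\alpha,\beta]\bigr)=\frac{\log(\beta/\alpha)}{\log n}\left(1+O_{\alpha,\beta}\!\left(\frac1{\log n}\right)\right)\qquad(n\to\infty),$$ where the subscript means that the implied constant, and the threshold for $n$ beyond which the bound holds, may depend on $\alpha$ and $\beta$ only. -/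

import Mathlib

open MeasureTheory Filter Asymptotics

/-- The formula of the Farey map takes values in `[0,1]`. -/
theorem fareyFormula_mem (x : unitInterval) :
    (if (x : ℝ) ≤ 1 / 2 then (x : ℝ) / (1 - x) else (1 - (x : ℝ)) / x) ∈ Set.Icc (0 : ℝ) 1 := by
  have h0 : (0 : ℝ) ≤ x := x.2.1
  have h1 : (x : ℝ) ≤ 1 := x.2.2
  split_ifs with h
  · exact ⟨div_nonneg h0 (by linarith), (div_le_one (by linarith)).2 (by linarith)⟩
  · push Not at h
    exact ⟨div_nonneg (by linarith) h0, (div_le_one (by linarith)).2 (by linarith)⟩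

/-- The Farey map `F : [0,1] → [0,1]`: `F x = x / (1 - x)` for `0 ≤ x ≤ 1/2` and
`F x = (1 - x) / x` for `1/2 < x ≤ 1`. -/
noncomputable def fareyMap (x : unitInterval) : unitInterval :=
  ⟨if (x : ℝ) ≤ 1 / 2 then (x : ℝ) / (1 - x) else (1 - (x : ℝ)) / x, fareyFormula_mem x⟩

/-- The preimage `F^{-k}[α,β]`, a subset of `[0,1]`. -/
def fareyPreimage (k : ℕ) (α β : ℝ) : Set unitInterval :=
  fareyMap^[k] ⁻¹' {x | (x : ℝ) ∈ Set.Icc α β}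

/-!
The Farey map preserves the infinite measure `dx / x`. With `h_n = fareyDensity n` the density of
the law of `F^n` relative to that measure, `λ(F^{-n}[α,β]) = ∫_α^β h_n(x) dx/x`
(`volume_fareyPreimage`), so it has to be shown that `h_n = (1 + O(1 / log n)) / log n` uniformly on
`[α,1]`. The argument is a renewal argument made elementary by monotonicity.

The transfer operator preserves the class of increasing concave functions on `[0,1]`
(`fareyTransfer_monotoneOn_concaveOn`), and `h_0(x) = x` belongs to it. Hence every `h_n` is
increasing, and `a_n = h_n(1)` is decreasing in `n`, because `h_{n+1}(1) = h_n(1/2)`. Splitting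
the unit mass according to the last visit of the orbit to `[1/2,1]` gives (`renewal_one`)

  `1 - 1/(n+1) = ∑_{i<n} ∫_{(i+1)/(i+2)}^1 h_{n-1-i}(x) dx/x`,

and the `i`-th integral lies between `a_{n-i} log((i+2)/(i+1))` and `a_{n-1-i} log((i+2)/(i+1))`.
As `a` decreases, the first bound yields `a_n log(n+1) ≤ 1`. The second bound at time `2m` yields
`1 - O(1/m) ≤ a_m log(m+1) + (1/m) ∑_{k<m} a_k`, where the last mean is `O(1 / log m)` by the
upper bound just found. So `a_m log m = 1 + O(1 / log m)`. The transfer equation at the points `1/j`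
carries the lower bound from `1` to `1/2, 1/3, …` (`exists_le_fareyDensity_mul_log`), and
monotonicity makes it uniform on `[α,1]`.
-/

open Set

/-- The transfer operator of the Farey map with respect to its infinite invariant measure `dx / x`,
that is `g ↦ x · P (g / x)` with `P` the transfer operator for Lebesgue measure. -/
noncomputable def fareyTransfer (g : ℝ → ℝ) (x : ℝ) : ℝ :=
  (g (x / (1 + x)) + x * g (1 / (1 + x))) / (1 + x)

/-- The density of the law of `F^n` under Lebesgue measure, relative to the invariant measure
`dx / x`. For `n = 0` this is `x`, the density of Lebesgue measure itself. -/
noncomputable def fareyDensity (n : ℕ) : ℝ → ℝ := fareyTransfer^[n] id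

theorem fareyDensity_succ (n : ℕ) : fareyDensity (n + 1) = fareyTransfer (fareyDensity n) :=
  Function.iterate_succ_apply' _ _ _

/-! ### Monotonicity and concavity -/

theorem div_one_add_eq (x : ℝ) (hx : 0 ≤ x) : x / (1 + x) = 1 - 1 / (1 + x) := by
  have : 1 + x ≠ 0 := by positivity
  field_simp
  ring

theorem monotoneOn_div_one_add : MonotoneOn (fun x : ℝ => x / (1 + x)) (Icc 0 1) := by
  intro x hx y hy hxy
  have := hx.1
  have := hy.1
  change x / (1 + x) ≤ y / (1 + y)
  rw [div_le_div_iff₀ (by positivity) (by positivity)]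
  nlinarith

theorem concaveOn_div_one_add : ConcaveOn ℝ (Icc 0 1) (fun x : ℝ => x / (1 + x)) := by
  refine ⟨convex_Icc 0 1, ?_⟩
  intro x hx y hy p q hp hq hpq
  have hx0 := hx.1
  have hy0 := hy.1
  simp only [smul_eq_mul]
  obtain rfl : q = 1 - p := by linarith
  have hz : 0 ≤ p * x + (1 - p) * y := by positivity
  rw [← sub_nonneg]
  have : (p * x + (1 - p) * y) / (1 + (p * x + (1 - p) * y))
      - (p * (x / (1 + x)) + (1 - p) * (y / (1 + y)))
      = p * (1 - p) * (x - y) ^ 2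
        / ((1 + (p * x + (1 - p) * y)) * (1 + x) * (1 + y)) := by
    have h1 : 1 + x ≠ 0 := by positivity
    have h2 : 1 + y ≠ 0 := by positivity
    have h3 : 1 + (p * x + (1 - p) * y) ≠ 0 := by positivity
    field_simp
    ring
  rw [this]
  positivity

theorem div_one_add_mem {x : ℝ} (hx : x ∈ Icc (0 : ℝ) 1) : x / (1 + x) ∈ Icc (0 : ℝ) (1 / 2) := by
  have h0 := hx.1
  have h1 := hx.2
  exact ⟨by positivity, by rw [div_le_div_iff₀ (by positivity) (by norm_num)]; linarith⟩

/-- In the coordinate `t = x / (1 + x)` the transfer operator sends `g` to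
`(1 - t) g(t) + t g(1 - t)`. -/
theorem fareyTransfer_eq (g : ℝ → ℝ) {x : ℝ} (hx : 0 ≤ x) :
    fareyTransfer g x
      = (1 - x / (1 + x)) * g (x / (1 + x)) + x / (1 + x) * g (1 - x / (1 + x)) := by
  have : 1 + x ≠ 0 := by positivity
  have h : 1 - x / (1 + x) = 1 / (1 + x) := by rw [div_one_add_eq x hx]; ring
  rw [h, fareyTransfer]
  field_simp

/-- For concave `g`, increments over intervals of equal length decrease. -/
theorem ConcaveOn.sub_le_sub_reflect {g : ℝ → ℝ} (hg : ConcaveOn ℝ (Icc 0 1) g) {s t : ℝ}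
    (hs : 0 ≤ s) (hst : s ≤ t) (ht : t ≤ 1 / 2) : g (1 - s) - g (1 - t) ≤ g t - g s := by
  rcases hst.eq_or_lt with rfl | hlt
  · simp
  have hpos : 0 < 1 - 2 * s := by linarith
  have hne : 1 - 2 * s ≠ 0 := hpos.ne'
  -- `t` and `1 - t` are the points dividing `[s, 1 - s]` in complementary ratios
  have hp : 0 ≤ (1 - s - t) / (1 - 2 * s) := div_nonneg (by linarith) hpos.le
  have hq : 0 ≤ (t - s) / (1 - 2 * s) := div_nonneg (by linarith) hpos.le
  have hpq : (1 - s - t) / (1 - 2 * s) + (t - s) / (1 - 2 * s) = 1 := by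
    rw [← add_div, div_eq_one_iff_eq hne]; ring
  have hmul := div_mul_cancel₀ (1 - s - t) hne
  have hsm : s ∈ Icc (0 : ℝ) 1 := ⟨hs, by linarith⟩
  have hsm' : 1 - s ∈ Icc (0 : ℝ) 1 := ⟨by linarith, by linarith⟩
  have h1 := hg.2 hsm hsm' hp hq hpq
  have h2 := hg.2 hsm' hsm hp hq hpq
  simp only [smul_eq_mul] at h1 h2
  have e1 : (1 - s - t) / (1 - 2 * s) * s + (t - s) / (1 - 2 * s) * (1 - s) = t := by
    linear_combination (1 - s) * hpq - hmul
  have e2 : (1 - s - t) / (1 - 2 * s) * (1 - s) + (t - s) / (1 - 2 * s) * s = 1 - t := by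
    linear_combination s * hpq + hmul
  rw [e1] at h1
  rw [e2] at h2
  linear_combination h1 + h2 - (g s + g (1 - s)) * hpq

theorem monotoneOn_reflect_combination {g : ℝ → ℝ} (hm : MonotoneOn g (Icc 0 1))
    (hc : ConcaveOn ℝ (Icc 0 1) g) :
    MonotoneOn (fun t => (1 - t) * g t + t * g (1 - t)) (Icc 0 (1 / 2)) := by
  intro s hs t ht hst
  have hs0 := hs.1
  have ht1 := ht.2
  have h1 : g (1 - s) - g (1 - t) ≤ g t - g s := hc.sub_le_sub_reflect hs0 hst ht1
  have h2 : g (1 - t) ≤ g (1 - s) :=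
    hm ⟨by linarith, by linarith⟩ ⟨by linarith, by linarith⟩ (by linarith)
  have h3 : g s ≤ g (1 - s) :=
    hm ⟨by linarith, by linarith⟩ ⟨by linarith, by linarith⟩ (by linarith)
  change (1 - s) * g s + s * g (1 - s) ≤ (1 - t) * g t + t * g (1 - t)
  have k1 : t * (g (1 - s) - g (1 - t)) ≤ (1 - t) * (g t - g s) :=
    mul_le_mul (by linarith) h1 (by linarith) (by linarith)
  have k2 : 0 ≤ (t - s) * (g (1 - s) - g s) := mul_nonneg (by linarith) (by linarith)
  linarith

theorem concaveOn_reflect_combination {g : ℝ → ℝ} (hm : MonotoneOn g (Icc 0 1))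
    (hc : ConcaveOn ℝ (Icc 0 1) g) :
    ConcaveOn ℝ (Icc 0 (1 / 2)) (fun t => (1 - t) * g t + t * g (1 - t)) := by
  refine LinearOrder.concaveOn_of_lt (convex_Icc _ _) ?_
  intro s hs r hr hsr p q hp hq hpq
  obtain rfl : p = 1 - q := by linarith
  have hs0 := hs.1
  have hr1 := hr.2
  have hsm : s ∈ Icc (0 : ℝ) 1 := ⟨by linarith, by linarith⟩
  have hrm : r ∈ Icc (0 : ℝ) 1 := ⟨by linarith, by linarith⟩
  have hsm' : 1 - s ∈ Icc (0 : ℝ) 1 := ⟨by linarith, by linarith⟩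
  have hrm' : 1 - r ∈ Icc (0 : ℝ) 1 := ⟨by linarith, by linarith⟩
  have c1 := hc.2 hsm hrm hp.le hq.le hpq
  have c2 := hc.2 hsm' hrm' hp.le hq.le hpq
  have m1 := hm hsm hrm hsr.le
  have m2 := hm hrm' hsm' (by linarith)
  simp only [smul_eq_mul] at c1 c2 ⊢
  have e : (1 - q) * (1 - s) + q * (1 - r) = 1 - ((1 - q) * s + q * r) := by ring
  rw [e] at c2
  set t := (1 - q) * s + q * r with ht
  have ht0 : 0 ≤ t := by have := hrm.1; positivity
  have ht1 : 0 ≤ 1 - t := by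
    rw [← e]; have := hsm'.1; have := hrm'.1; positivity
  have k1 := mul_le_mul_of_nonneg_left c1 ht1
  have k2 := mul_le_mul_of_nonneg_left c2 ht0
  have k3 : 0 ≤ (1 - q) * q * (r - s) * (g r - g s) :=
    mul_nonneg (mul_nonneg (by positivity) (by linarith)) (by linarith)
  have k4 : 0 ≤ (1 - q) * q * (r - s) * (g (1 - s) - g (1 - r)) :=
    mul_nonneg (mul_nonneg (by positivity) (by linarith)) (by linarith)
  have i1 : (1 - t) * ((1 - q) * g s + q * g r) =
      (1 - q) * ((1 - s) * g s) + q * ((1 - r) * g r)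
        + (1 - q) * q * (r - s) * (g s - g r) + 2 * ((1 - q) * q * (r - s) * (g r - g s)) := by
    rw [ht]; ring
  have i2 : t * ((1 - q) * g (1 - s) + q * g (1 - r)) =
      (1 - q) * (s * g (1 - s)) + q * (r * g (1 - r))
        + (1 - q) * q * (r - s) * (g (1 - s) - g (1 - r)) := by
    rw [ht]; ring
  nlinarith

theorem fareyTransfer_monotoneOn_concaveOn {g : ℝ → ℝ}
    (hm : MonotoneOn g (Icc 0 1)) (hc : ConcaveOn ℝ (Icc 0 1) g) :
    MonotoneOn (fareyTransfer g) (Icc 0 1) ∧ ConcaveOn ℝ (Icc 0 1) (fareyTransfer g) := by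
  have hM := monotoneOn_reflect_combination hm hc
  have hC := concaveOn_reflect_combination hm hc
  constructor
  · intro x hx y hy hxy
    rw [fareyTransfer_eq g hx.1, fareyTransfer_eq g hy.1]
    exact hM (div_one_add_mem hx) (div_one_add_mem hy) (monotoneOn_div_one_add hx hy hxy)
  · refine ⟨convex_Icc 0 1, ?_⟩
    intro x hx y hy p q hp hq hpq
    have hz := convex_Icc (0 : ℝ) 1 hx hy hp hq hpq
    rw [fareyTransfer_eq g hx.1, fareyTransfer_eq g hy.1, fareyTransfer_eq g hz.1]
    have hmid := convex_Icc (0 : ℝ) (1 / 2) (div_one_add_mem hx) (div_one_add_mem hy) hp hq hpq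
    exact (hC.2 (div_one_add_mem hx) (div_one_add_mem hy) hp hq hpq).trans
      (hM hmid (div_one_add_mem hz) (concaveOn_div_one_add.2 hx hy hp hq hpq))

theorem fareyDensity_monotoneOn_concaveOn (n : ℕ) :
    MonotoneOn (fareyDensity n) (Icc 0 1) ∧ ConcaveOn ℝ (Icc 0 1) (fareyDensity n) := by
  induction n with
  | zero => exact ⟨monotone_id.monotoneOn _, concaveOn_id (convex_Icc 0 1)⟩
  | succ n ih =>
    rw [fareyDensity_succ]
    exact fareyTransfer_monotoneOn_concaveOn ih.1 ih.2

theorem fareyDensity_mono (n : ℕ) {x y : ℝ} (hx : 0 ≤ x) (hxy : x ≤ y) (hy : y ≤ 1) :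
    fareyDensity n x ≤ fareyDensity n y :=
  (fareyDensity_monotoneOn_concaveOn n).1 ⟨hx, hxy.trans hy⟩ ⟨hx.trans hxy, hy⟩ hxy

theorem fareyDensity_apply_zero (n : ℕ) : fareyDensity n 0 = 0 := by
  induction n with
  | zero => rfl
  | succ n ih => simp [fareyDensity_succ, fareyTransfer, ih]

theorem fareyDensity_nonneg (n : ℕ) {x : ℝ} (hx : 0 ≤ x) (hx1 : x ≤ 1) :
    0 ≤ fareyDensity n x := by
  simpa [fareyDensity_apply_zero] using fareyDensity_mono n le_rfl hx hx1

theorem fareyDensity_succ_one (n : ℕ) : fareyDensity (n + 1) 1 = fareyDensity n (1 / 2) := by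
  rw [fareyDensity_succ, fareyTransfer]
  norm_num

theorem antitone_fareyDensity_one : Antitone (fun n => fareyDensity n 1) := by
  refine antitone_nat_of_succ_le fun n => ?_
  rw [fareyDensity_succ_one]
  exact fareyDensity_mono n (by norm_num) (by norm_num) le_rfl

theorem fareyDensity_one_le_one (n : ℕ) : fareyDensity n 1 ≤ 1 :=
  antitone_fareyDensity_one (Nat.zero_le n)

theorem continuousOn_fareyTransfer {g : ℝ → ℝ} (hg : ContinuousOn g (Icc 0 1)) :
    ContinuousOn (fareyTransfer g) (Icc 0 1) := by
  have hne : ∀ x ∈ Icc (0 : ℝ) 1, 1 + x ≠ 0 := fun x hx => by have := hx.1; positivity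
  have h1 : ContinuousOn (fun x : ℝ => x / (1 + x)) (Icc 0 1) :=
    continuousOn_id.div (by fun_prop) hne
  have h2 : ContinuousOn (fun x : ℝ => 1 / (1 + x)) (Icc 0 1) :=
    continuousOn_const.div (by fun_prop) hne
  refine ContinuousOn.div (ContinuousOn.add ?_ (continuousOn_id.mul ?_)) (by fun_prop) hne
  · refine hg.comp h1 fun x hx => ⟨(div_one_add_mem hx).1, (div_one_add_mem hx).2.trans ?_⟩
    norm_num
  · refine hg.comp h2 fun x hx => ?_
    have := hx.1
    exact ⟨by positivity, by rw [div_le_one (by positivity)]; linarith⟩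

theorem continuousOn_fareyDensity (n : ℕ) : ContinuousOn (fareyDensity n) (Icc 0 1) := by
  induction n with
  | zero => exact continuousOn_id
  | succ n ih => rw [fareyDensity_succ]; exact continuousOn_fareyTransfer ih

/-! ### Change of variables -/

theorem continuousOn_div_self {g : ℝ → ℝ} (hg : ContinuousOn g (Icc 0 1)) :
    ContinuousOn (fun x => g x / x) (Ioc 0 1) :=
  (hg.mono Ioc_subset_Icc_self).div continuousOn_id fun _ hx => hx.1.ne'

theorem intervalIntegrable_div_self {g : ℝ → ℝ} (hg : ContinuousOn g (Icc 0 1)) {a b : ℝ}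
    (ha : a ∈ Ioc (0 : ℝ) 1) (hb : b ∈ Ioc (0 : ℝ) 1) :
    IntervalIntegrable (fun x => g x / x) volume a b :=
  ((continuousOn_div_self hg).mono
    (OrdConnected.uIcc_subset ordConnected_Ioc ha hb)).intervalIntegrable

theorem div_one_add_mem_Ioc {x : ℝ} (hx : x ∈ Ioc (0 : ℝ) 1) : x / (1 + x) ∈ Ioc (0 : ℝ) 1 := by
  have h0 := hx.1
  exact ⟨by positivity, by rw [div_le_one (by positivity)]; linarith⟩

theorem one_div_one_add_mem_Ioc {x : ℝ} (hx : x ∈ Ioc (0 : ℝ) 1) :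
    1 / (1 + x) ∈ Ioc (0 : ℝ) 1 := by
  have h0 := hx.1
  exact ⟨by positivity, by rw [div_le_one (by positivity)]; linarith⟩

/-- The two inverse branches `x / (1 + x)` and `1 / (1 + x)` of the Farey map, used as
substitutions. -/
theorem integral_fareyTransfer {g : ℝ → ℝ} (hg : ContinuousOn g (Icc 0 1)) {a b : ℝ}
    (ha : a ∈ Ioc (0 : ℝ) 1) (hb : b ∈ Ioc (0 : ℝ) 1) :
    ∫ x in a..b, fareyTransfer g x / x
      = (∫ x in (a / (1 + a))..(b / (1 + b)), g x / x)
        + ∫ x in (1 / (1 + b))..(1 / (1 + a)), g x / x := by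
  have hsub : uIcc a b ⊆ Ioc 0 1 := OrdConnected.uIcc_subset ordConnected_Ioc ha hb
  have hne : ∀ x ∈ uIcc a b, 1 + x ≠ 0 := fun x hx => by have := (hsub hx).1; positivity
  have hcont : ContinuousOn (fun x : ℝ => 1 / (1 + x) ^ 2) (uIcc a b) :=
    continuousOn_const.div (by fun_prop) fun x hx => pow_ne_zero 2 (hne x hx)
  have hd1 : ∀ x ∈ uIcc a b, HasDerivAt (fun x : ℝ => x / (1 + x)) (1 / (1 + x) ^ 2) x := by
    intro x hx
    have := (hasDerivAt_id x).div ((hasDerivAt_id x).const_add 1) (hne x hx)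
    refine this.congr_deriv ?_
    simp
  have hd2 : ∀ x ∈ uIcc a b, HasDerivAt (fun x : ℝ => 1 / (1 + x)) (-(1 / (1 + x) ^ 2)) x := by
    intro x hx
    have := (hasDerivAt_const x (1 : ℝ)).div ((hasDerivAt_id x).const_add 1) (hne x hx)
    refine this.congr_deriv ?_
    simp [neg_div]
  have hgc := continuousOn_div_self hg
  have hg1 : ContinuousOn (fun x => g x / x) ((fun x : ℝ => x / (1 + x)) '' uIcc a b) :=
    hgc.mono (image_subset_iff.2 fun x hx => div_one_add_mem_Ioc (hsub hx))
  have hg2 : ContinuousOn (fun x => g x / x) ((fun x : ℝ => 1 / (1 + x)) '' uIcc a b) :=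
    hgc.mono (image_subset_iff.2 fun x hx => one_div_one_add_mem_Ioc (hsub hx))
  have s1 := intervalIntegral.integral_comp_mul_deriv' hd1 hcont hg1
  have s2 := intervalIntegral.integral_comp_mul_deriv' hd2 hcont.neg hg2
  have c1 : ContinuousOn (fun x : ℝ => x / (1 + x)) (uIcc a b) :=
    fun x hx => (hd1 x hx).continuousAt.continuousWithinAt
  have c2 : ContinuousOn (fun x : ℝ => 1 / (1 + x)) (uIcc a b) :=
    fun x hx => (hd2 x hx).continuousAt.continuousWithinAt
  have i1 := ((hg1.comp c1 (mapsTo_image _ _)).mul hcont).intervalIntegrable (μ := volume)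
  have i2 := ((hg2.comp c2 (mapsTo_image _ _)).mul hcont.neg).intervalIntegrable (μ := volume)
  rw [intervalIntegral.integral_symm (1 / (1 + a)), ← s1, ← s2, ← sub_eq_add_neg]
  refine Eq.trans ?_ (intervalIntegral.integral_sub i1 i2)
  refine intervalIntegral.integral_congr fun x hx => ?_
  have hx0 := (hsub hx).1
  have h1 : 1 + x ≠ 0 := hne x hx
  simp only [fareyTransfer, Function.comp]
  field_simp
  ring

/-! ### The measure of the preimages as an integral -/

theorem measurable_fareyMap : Measurable fareyMap := by
  refine Measurable.subtype_mk (Measurable.ite ?_ ?_ ?_)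
  · exact measurableSet_le measurable_subtype_coe measurable_const
  · exact measurable_subtype_coe.div (measurable_const.sub measurable_subtype_coe)
  · exact (measurable_const.sub measurable_subtype_coe).div measurable_subtype_coe

theorem measurableSet_fareyPreimage (k : ℕ) (a b : ℝ) : MeasurableSet (fareyPreimage k a b) :=
  (measurable_fareyMap.iterate k) (measurable_subtype_coe measurableSet_Icc)

theorem fareyPreimage_succ (k : ℕ) {a b : ℝ} (ha : a ∈ Ioc (0 : ℝ) 1) (hb : b ∈ Ioc (0 : ℝ) 1) :
    fareyPreimage (k + 1) a b
      = fareyPreimage k (a / (1 + a)) (b / (1 + b))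
        ∪ fareyPreimage k (1 / (1 + b)) (1 / (1 + a)) := by
  have ha0 := ha.1
  have hb0 := hb.1
  have hb1 := hb.2
  ext x
  simp only [fareyPreimage, mem_preimage, mem_union, mem_ofPred_eq, Function.iterate_succ_apply']
  generalize fareyMap^[k] x = y
  have hy0 : (0 : ℝ) ≤ y := y.2.1
  have hy1 : (y : ℝ) ≤ 1 := y.2.2
  simp only [fareyMap, mem_Icc]
  have ha2 : 0 < 1 + a := by positivity
  have hb2 : 0 < 1 + b := by positivity
  rw [div_le_iff₀ ha2, le_div_iff₀ hb2, div_le_iff₀ hb2, le_div_iff₀ ha2]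
  split_ifs with h
  · rw [le_div_iff₀ (by linarith), div_le_iff₀ (by linarith)]
    constructor
    · rintro ⟨h1, h2⟩
      left; constructor <;> linarith
    · rintro (⟨h1, h2⟩ | ⟨h1, h2⟩)
      · constructor <;> linarith
      · -- here `y = 1 / 2` and `b = 1`, where both branches take the value `1`
        have : (y : ℝ) * (1 + b) ≤ 1 / 2 * (1 + b) := by gcongr
        have hb' : b = 1 := by linarith
        subst hb'
        constructor <;> nlinarith
  · push Not at h
    rw [le_div_iff₀ (by linarith), div_le_iff₀ (by linarith)]
    constructor
    · rintro ⟨h1, h2⟩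
      right; constructor <;> nlinarith
    · rintro (⟨h1, h2⟩ | ⟨h1, h2⟩)
      · have : (1 / 2 : ℝ) * (1 + b) < y * (1 + b) := by gcongr
        exfalso; linarith
      · constructor <;> nlinarith

theorem fareyPreimage_inter_subset (k : ℕ) {a b : ℝ} (hb0 : 0 < b) (hb1 : b ≤ 1) :
    fareyPreimage k (a / (1 + a)) (b / (1 + b)) ∩ fareyPreimage k (1 / (1 + b)) (1 / (1 + a))
      ⊆ fareyPreimage k (1 / 2) (1 / 2) := by
  rintro x ⟨⟨-, h1⟩, ⟨h2, -⟩⟩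
  have h3 : b / (1 + b) ≤ 1 / 2 := (div_one_add_mem ⟨hb0.le, hb1⟩).2
  have h4 : 1 / 2 ≤ 1 / (1 + b) := by
    rw [div_le_div_iff₀ (by norm_num) (by positivity)]; linarith
  exact ⟨h4.trans h2, h1.trans h3⟩

theorem volume_fareyPreimage (k : ℕ) {a b : ℝ} (ha : 0 < a) (hab : a ≤ b) (hb : b ≤ 1) :
    (volume : Measure unitInterval).real (fareyPreimage k a b)
      = ∫ x in a..b, fareyDensity k x / x := by
  induction k generalizing a b with
  | zero =>
    have e : ∫ x in a..b, fareyDensity 0 x / x = ∫ x in a..b, (1 : ℝ) := by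
      refine intervalIntegral.integral_congr fun x hx => ?_
      rw [uIcc_of_le hab] at hx
      exact div_self (ha.trans_le hx.1).ne'
    rw [e, intervalIntegral.integral_const, smul_eq_mul, mul_one]
    have himg : Subtype.val '' fareyPreimage 0 a b = Icc a b := by
      ext x
      constructor
      · rintro ⟨y, hy, rfl⟩
        exact hy
      · intro hx
        exact ⟨⟨x, ha.le.trans hx.1, hx.2.trans hb⟩, hx, rfl⟩
    rw [measureReal_def, unitInterval.volume_apply, himg, Real.volume_Icc,
      ENNReal.toReal_ofReal (by linarith)]
  | succ k ih =>
    have ham : a ∈ Ioc (0 : ℝ) 1 := ⟨ha, hab.trans hb⟩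
    have hbm : b ∈ Ioc (0 : ℝ) 1 := ⟨ha.trans_le hab, hb⟩
    have hnull : (volume : Measure unitInterval).real (fareyPreimage k (1 / 2) (1 / 2)) = 0 := by
      rw [ih (by norm_num) le_rfl (by norm_num), intervalIntegral.integral_same]
    have hdisj : AEDisjoint volume (fareyPreimage k (a / (1 + a)) (b / (1 + b)))
        (fareyPreimage k (1 / (1 + b)) (1 / (1 + a))) :=
      measure_mono_null (fareyPreimage_inter_subset k hbm.1 hb)
        ((measureReal_eq_zero_iff).1 hnull)
    have hb0 := hbm.1
    rw [fareyPreimage_succ k ham hbm,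
      measureReal_union₀ (measurableSet_fareyPreimage _ _ _).nullMeasurableSet hdisj,
      ih (div_one_add_mem_Ioc ham).1
        (monotoneOn_div_one_add ⟨ha.le, ham.2⟩ ⟨hb0.le, hb⟩ hab) (div_one_add_mem_Ioc hbm).2,
      ih (one_div_one_add_mem_Ioc hbm).1 (by gcongr) (one_div_one_add_mem_Ioc ham).2,
      fareyDensity_succ, integral_fareyTransfer (continuousOn_fareyDensity k) ham hbm]

/-- Bounds for `g` on `[a,b]` bound `∫ g / x`. -/
theorem integral_div_self_mem_Icc {g : ℝ → ℝ} (hg : ContinuousOn g (Icc 0 1)) {a b m M : ℝ}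
    (ha : 0 < a) (hab : a ≤ b) (hb : b ≤ 1) (hm : ∀ x ∈ Icc a b, m ≤ g x)
    (hM : ∀ x ∈ Icc a b, g x ≤ M) :
    ∫ x in a..b, g x / x ∈ Icc (m * Real.log (b / a)) (M * Real.log (b / a)) := by
  have hb0 : 0 < b := ha.trans_le hab
  have hint := intervalIntegrable_div_self hg ⟨ha, hab.trans hb⟩ ⟨hb0, hb⟩
  have hc (c : ℝ) : IntervalIntegrable (fun x => c * x⁻¹) volume a b := by
    refine ContinuousOn.intervalIntegrable (continuousOn_const.mul ?_)
    rw [uIcc_of_le hab]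
    exact continuousOn_id.inv₀ fun x hx => (ha.trans_le hx.1).ne'
  have hv (c : ℝ) : ∫ x in a..b, c * x⁻¹ = c * Real.log (b / a) := by
    rw [intervalIntegral.integral_const_mul, integral_inv_of_pos ha hb0]
  rw [← hv, ← hv]
  refine ⟨intervalIntegral.integral_mono_on hab (hc m) hint fun x hx => ?_,
    intervalIntegral.integral_mono_on hab hint (hc M) fun x hx => ?_⟩
  · rw [div_eq_mul_inv]
    exact mul_le_mul_of_nonneg_right (hm x hx) (inv_nonneg.2 (ha.le.trans hx.1))
  · rw [div_eq_mul_inv]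
    exact mul_le_mul_of_nonneg_right (hM x hx) (inv_nonneg.2 (ha.le.trans hx.1))

/-! ### The renewal equation -/

/-- One step of the renewal argument: `F^(n+1) x > 1/(j+1)` holds unless `F^n x ≤ 1/(j+2)` or
`F^n x ≥ (j+1)/(j+2)`. -/
theorem integral_fareyDensity_succ (n j : ℕ) :
    ∫ x in (1 / ((j : ℝ) + 1))..1, fareyDensity (n + 1) x / x
      = (∫ x in (1 / ((j : ℝ) + 2))..1, fareyDensity n x / x)
        - ∫ x in (((j : ℝ) + 1) / (j + 2))..1, fareyDensity n x / x := by
  have hj : (0 : ℝ) ≤ j := j.cast_nonneg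
  have m1 : 1 / ((j : ℝ) + 1) ∈ Ioc (0 : ℝ) 1 :=
    ⟨by positivity, by rw [div_le_one (by positivity)]; linarith⟩
  have m2 : 1 / ((j : ℝ) + 2) ∈ Ioc (0 : ℝ) 1 :=
    ⟨by positivity, by rw [div_le_one (by positivity)]; linarith⟩
  have m3 : ((j : ℝ) + 1) / (j + 2) ∈ Ioc (0 : ℝ) 1 :=
    ⟨by positivity, by rw [div_le_one (by positivity)]; linarith⟩
  have m4 : (1 / 2 : ℝ) ∈ Ioc (0 : ℝ) 1 := by norm_num
  have m5 : (1 : ℝ) ∈ Ioc (0 : ℝ) 1 := by norm_num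
  have hc := continuousOn_fareyDensity n
  have e1 : 1 / ((j : ℝ) + 1) / (1 + 1 / (j + 1)) = 1 / (j + 2) := by field_simp; ring
  have e2 : 1 / (1 + 1 / ((j : ℝ) + 1)) = (j + 1) / (j + 2) := by field_simp; ring
  rw [fareyDensity_succ, integral_fareyTransfer hc m1 m5, e1, e2, one_add_one_eq_two,
    intervalIntegral.integral_add_adjacent_intervals (intervalIntegrable_div_self hc m2 m4)
      (intervalIntegrable_div_self hc m4 m3),
    ← intervalIntegral.integral_add_adjacent_intervals (intervalIntegrable_div_self hc m2 m3)
      (intervalIntegrable_div_self hc m3 m5)]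
  ring

/-- The last-visit decomposition. The points with `F^n x ≤ 1/(j+1)` either have never visited
`[1/2, 1]` before time `n`, which means `x ≤ 1/(n+j+1)`, or are counted by the sum: up to null
sets, the `i`-th term collects those whose last visit before time `n` is at time
`n - 1 - i`, at a point of `[(j+i+1)/(j+i+2), 1]`. -/
theorem renewal (n j : ℕ) :
    ∫ x in (1 / ((j : ℝ) + 1))..1, fareyDensity n x / x
      = 1 - 1 / ((n : ℝ) + j + 1)
        - ∑ i ∈ Finset.range n,
            ∫ x in (((j + i : ℕ) + 1 : ℝ) / ((j + i : ℕ) + 2))..1,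
              fareyDensity (n - 1 - i) x / x := by
  induction n generalizing j with
  | zero =>
    have e : ∫ x in (1 / ((j : ℝ) + 1))..1, fareyDensity 0 x / x
        = ∫ x in (1 / ((j : ℝ) + 1))..1, (1 : ℝ) := by
      refine intervalIntegral.integral_congr fun x hx => ?_
      have : (0 : ℝ) < x := lt_of_lt_of_le (by positivity) hx.1
      exact div_self this.ne'
    rw [e]
    simp
  | succ n ih =>
    have := ih (j + 1)
    push_cast at this
    rw [add_assoc (j : ℝ) 1 1, one_add_one_eq_two] at this
    rw [integral_fareyDensity_succ, this, Finset.sum_range_succ']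
    have e : ∀ i ∈ Finset.range n,
        ∫ x in (((j + (i + 1) : ℕ) + 1 : ℝ) / ((j + (i + 1) : ℕ) + 2))..1,
            fareyDensity (n + 1 - 1 - (i + 1)) x / x
        = ∫ x in (((j : ℝ) + 1 + i + 1) / (j + 1 + i + 2))..1,
            fareyDensity (n - 1 - i) x / x := by
      intro i _
      rw [show n + 1 - 1 - (i + 1) = n - 1 - i by omega]
      push_cast
      rw [show (j : ℝ) + (i + 1) = j + 1 + i by ring]
    rw [Finset.sum_congr rfl e]
    push_cast
    simp only [add_zero, Nat.sub_zero]
    rw [show (n : ℝ) + (j + 1) + 1 = n + 1 + j + 1 by ring]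
    ring

theorem renewal_one (n : ℕ) :
    ∑ i ∈ Finset.range n,
        ∫ x in (((i : ℝ) + 1) / (i + 2))..1, fareyDensity (n - 1 - i) x / x
      = 1 - 1 / ((n : ℝ) + 1) := by
  have := renewal n 0
  simp only [zero_add, Nat.cast_zero, div_one, add_zero, intervalIntegral.integral_same] at this
  linarith

theorem integral_fareyDensity_mem_Icc (n i : ℕ) :
    ∫ x in (((i : ℝ) + 1) / (i + 2))..1, fareyDensity n x / x
      ∈ Icc (fareyDensity (n + 1) 1 * (Real.log (i + 2) - Real.log (i + 1)))
          (fareyDensity n 1 * (Real.log (i + 2) - Real.log (i + 1))) := by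
  have hi : (0 : ℝ) ≤ i := i.cast_nonneg
  have h1 : ((i : ℝ) + 1) / (i + 2) ≤ 1 := by rw [div_le_one (by positivity)]; linarith
  have h2 : 1 / 2 ≤ ((i : ℝ) + 1) / (i + 2) := by
    rw [div_le_div_iff₀ (by norm_num) (by positivity)]; linarith
  have := integral_div_self_mem_Icc (continuousOn_fareyDensity n) (by positivity) h1 le_rfl
    (m := fareyDensity (n + 1) 1) (M := fareyDensity n 1)
    (fun x hx => by
      rw [fareyDensity_succ_one]
      exact fareyDensity_mono n (by norm_num) (h2.trans hx.1) hx.2)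
    (fun x hx => fareyDensity_mono n (by linarith [hx.1]) hx.2 le_rfl)
  rwa [one_div_div, Real.log_div (by positivity) (by positivity)] at this

theorem sum_log_sub (n : ℕ) :
    ∑ i ∈ Finset.range n, (Real.log ((i : ℝ) + 2) - Real.log (i + 1)) = Real.log (n + 1) := by
  have := Finset.sum_range_sub (fun i : ℕ => Real.log ((i : ℝ) + 1)) n
  simp only [Nat.cast_add, Nat.cast_one, Nat.cast_zero, zero_add, Real.log_one, sub_zero] at this
  rw [← this]
  refine Finset.sum_congr rfl fun i _ => ?_
  rw [add_assoc, one_add_one_eq_two]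

theorem log_sub_nonneg (i : ℕ) : 0 ≤ Real.log ((i : ℝ) + 2) - Real.log (i + 1) :=
  sub_nonneg.2 (Real.log_le_log (by positivity) (by linarith))

theorem log_sub_le (i : ℕ) : Real.log ((i : ℝ) + 2) - Real.log (i + 1) ≤ 1 / ((i : ℝ) + 1) := by
  rw [← Real.log_div (by positivity) (by positivity)]
  refine (Real.log_le_sub_one_of_pos (by positivity)).trans (le_of_eq ?_)
  field_simp
  ring

/-! ### Asymptotics of the density -/

theorem fareyDensity_one_mul_log_le (n : ℕ) : fareyDensity n 1 * Real.log (n + 1) ≤ 1 := by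
  have h : fareyDensity n 1 * Real.log (n + 1) ≤ 1 - 1 / ((n : ℝ) + 1) := by
    rw [← renewal_one, ← sum_log_sub, Finset.mul_sum]
    refine Finset.sum_le_sum fun i hi => ?_
    refine le_trans ?_ (integral_fareyDensity_mem_Icc _ i).1
    refine mul_le_mul_of_nonneg_right (antitone_fareyDensity_one ?_) (log_sub_nonneg i)
    have := Finset.mem_range.1 hi
    omega
  have : 0 ≤ 1 / ((n : ℝ) + 1) := by positivity
  linarith

/-- The Cesàro means of `fareyDensity k 1` are `O(1 / log m)`. -/
theorem sum_fareyDensity_one_le {m : ℕ} (hm : 2 ≤ m) :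
    (∑ k ∈ Finset.range m, fareyDensity k 1) / m ≤ 4 / Real.log m := by
  -- terms below `√m` are bounded by `1`, the others by `1 / log (√m + 1) ≤ 2 / log m`
  set s := Nat.sqrt m with hs
  have hs1 : 1 ≤ s := Nat.sqrt_pos.2 (by omega)
  have hsm : s ≤ m := Nat.sqrt_le_self m
  have hs1' : (1 : ℝ) ≤ s := by exact_mod_cast hs1
  have hm2 : (2 : ℝ) ≤ m := by exact_mod_cast hm
  have hss : (s : ℝ) * s ≤ m := by exact_mod_cast Nat.sqrt_le m
  have hlt : (m : ℝ) < (s + 1) * (s + 1) := by exact_mod_cast Nat.lt_succ_sqrt m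
  have hlog : 0 < Real.log m := Real.log_pos (by linarith)
  have hl2 : Real.log m ≤ 2 * Real.log (s + 1) := by
    have := Real.log_le_log (by linarith) hlt.le
    rw [Real.log_mul (by positivity) (by positivity)] at this
    linarith
  have hl3 : Real.log m ≤ 2 * s := by
    have := Real.log_le_sub_one_of_pos (show (0 : ℝ) < s + 1 by positivity)
    linarith
  have htail : ∀ k, s ≤ k → fareyDensity k 1 ≤ 2 / Real.log m := by
    intro k hk
    refine (antitone_fareyDensity_one hk).trans ?_
    rw [le_div_iff₀ hlog]
    have h1 := fareyDensity_one_mul_log_le s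
    have h2 := mul_le_mul_of_nonneg_left hl2 (fareyDensity_nonneg s zero_le_one le_rfl)
    change fareyDensity s 1 * _ ≤ _
    linarith
  have hsum : ∑ k ∈ Finset.range m, fareyDensity k 1 ≤ s + m * (2 / Real.log m) := by
    rw [← Finset.sum_range_add_sum_Ico _ hsm]
    refine add_le_add ?_ ?_
    · refine (Finset.sum_le_card_nsmul _ _ 1 fun k _ => fareyDensity_one_le_one k).trans ?_
      simp
    · refine (Finset.sum_le_card_nsmul _ _ (2 / Real.log m)
        fun k hk => htail k (Finset.mem_Ico.1 hk).1).trans ?_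
      rw [Nat.card_Ico, nsmul_eq_mul]
      refine mul_le_mul_of_nonneg_right ?_ (by positivity)
      exact_mod_cast Nat.sub_le m s
  have hsq : (s : ℝ) ≤ m * (2 / Real.log m) := by
    rw [mul_div_assoc', le_div_iff₀ hlog]
    nlinarith
  rw [div_le_iff₀ (by linarith)]
  calc _ ≤ _ := hsum
    _ ≤ m * (2 / Real.log m) + m * (2 / Real.log m) := by linarith
    _ = _ := by ring

/-- The renewal equation at time `2m`: the indices `i < m` carry weight `log (m + 1)`, and each
weight with `i ≥ m` is at most `1 / m`. -/
theorem le_fareyDensity_one_mul_log_add {m : ℕ} (hm : 1 ≤ m) :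
    1 - 1 / (2 * (m : ℝ) + 1)
      ≤ fareyDensity m 1 * Real.log (m + 1) + (∑ k ∈ Finset.range m, fareyDensity k 1) / m := by
  have hm0 : (0 : ℝ) < m := by exact_mod_cast hm
  have h := renewal_one (m + m)
  rw [Finset.sum_range_add] at h
  have e : ((m + m : ℕ) : ℝ) + 1 = 2 * m + 1 := by push_cast; ring
  rw [← e, ← h]
  refine add_le_add ?_ ?_
  · rw [← sum_log_sub, Finset.mul_sum]
    refine Finset.sum_le_sum fun i hi => (integral_fareyDensity_mem_Icc _ i).2.trans ?_
    refine mul_le_mul_of_nonneg_right (antitone_fareyDensity_one ?_) (log_sub_nonneg i)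
    have := Finset.mem_range.1 hi
    omega
  · rw [← Finset.sum_range_reflect (fun k => fareyDensity k 1), Finset.sum_div]
    refine Finset.sum_le_sum fun i hi => ?_
    refine (integral_fareyDensity_mem_Icc _ (m + i)).2.trans ?_
    rw [show m + m - 1 - (m + i) = m - 1 - i by omega, div_eq_mul_one_div _ (m : ℝ)]
    refine mul_le_mul_of_nonneg_left ((log_sub_le (m + i)).trans ?_)
      (fareyDensity_nonneg _ zero_le_one le_rfl)
    refine one_div_le_one_div_of_le hm0 ?_
    push_cast
    have : (0 : ℝ) ≤ i := i.cast_nonneg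
    linarith

theorem one_div_nat_le_one_div_log {m : ℕ} (hm : 2 ≤ m) : 1 / (m : ℝ) ≤ 1 / Real.log m := by
  have hm2 : (2 : ℝ) ≤ m := by exact_mod_cast hm
  refine one_div_le_one_div_of_le (Real.log_pos (by linarith)) ?_
  linarith [Real.log_le_sub_one_of_pos (show (0 : ℝ) < m by linarith)]

/-- Replacing `log (m + 1)` by `log m` costs at most `1 / m`. -/
theorem mul_log_succ_le {m : ℕ} (hm : 2 ≤ m) {c : ℝ} (hc0 : 0 ≤ c) (hc1 : c ≤ 1) :
    c * Real.log (m + 1) ≤ c * Real.log m + 1 / Real.log m := by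
  have hl := log_sub_le (m - 1)
  rw [Nat.cast_sub (by omega), Nat.cast_one, sub_add_cancel,
    show (m : ℝ) - 1 + 2 = m + 1 by ring] at hl
  have h1 := mul_le_mul_of_nonneg_left (hl.trans (one_div_nat_le_one_div_log hm)) hc0
  have h2 : c * (1 / Real.log m) ≤ 1 * (1 / Real.log m) :=
    mul_le_mul_of_nonneg_right hc1 (one_div_nonneg.2 (Real.log_natCast_nonneg m))
  linarith

theorem le_fareyDensity_one_mul_log {m : ℕ} (hm : 2 ≤ m) :
    1 - 6 / Real.log m ≤ fareyDensity m 1 * Real.log m := by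
  have hm2 : (2 : ℝ) ≤ m := by exact_mod_cast hm
  have h1 := le_fareyDensity_one_mul_log_add (show 1 ≤ m by omega)
  have h2 := sum_fareyDensity_one_le hm
  have h3 : 1 / (2 * (m : ℝ) + 1) ≤ 1 / Real.log m :=
    (one_div_le_one_div_of_le (by linarith) (by linarith)).trans (one_div_nat_le_one_div_log hm)
  have h4 := mul_log_succ_le hm (fareyDensity_nonneg m zero_le_one le_rfl)
    (fareyDensity_one_le_one m)
  have e : 6 / Real.log m = 4 / Real.log m + 1 / Real.log m + 1 / Real.log m := by ring
  linarith

/-- The lower bound at `1` propagates to `1/2, 1/3, …`, since the transfer operator at `1/j` is an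
average of the values at `1/(j+1)` and at `j/(j+1)`, the latter being at most the value at `1`. -/
theorem exists_le_fareyDensity_mul_log (j : ℕ) :
    ∃ C : ℝ, 0 ≤ C ∧ ∀ n : ℕ, 2 ≤ n →
      1 - C / Real.log n ≤ fareyDensity n (1 / ((j : ℝ) + 1)) * Real.log n := by
  induction j with
  | zero =>
    refine ⟨6, by norm_num, fun n hn => ?_⟩
    simpa using le_fareyDensity_one_mul_log hn
  | succ j ih =>
    obtain ⟨C, hC0, hC⟩ := ih
    refine ⟨2 * (C + 1), by positivity, fun n hn => ?_⟩
    have hj : (0 : ℝ) ≤ j := j.cast_nonneg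
    have hn2 : (2 : ℝ) ≤ n := by exact_mod_cast hn
    have hlog : 0 < Real.log n := Real.log_pos (by linarith)
    have hlog' : Real.log n ≤ Real.log (n + 1) := Real.log_le_log (by linarith) (by linarith)
    have m1 : 1 / ((j : ℝ) + 1) ≤ 1 := by rw [div_le_one (by positivity)]; linarith
    have h1 := hC (n + 1) (by omega)
    push_cast at h1
    set u := fareyDensity (n + 1) (1 / ((j : ℝ) + 1)) with hu
    have hu0 : 0 ≤ u := fareyDensity_nonneg _ (by positivity) m1
    have hu1 : u ≤ 1 :=
      (fareyDensity_mono _ (by positivity) m1 le_rfl).trans (fareyDensity_one_le_one _)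
    have h2 := mul_log_succ_le hn hu0 hu1
    have h3 : C / Real.log (n + 1) ≤ C / Real.log n := by gcongr
    have h4 : 1 - (C + 1) / Real.log n ≤ u * Real.log n := by
      rw [add_div]; linarith
    have h5 : fareyDensity n 1 * Real.log n ≤ 1 :=
      (mul_le_mul_of_nonneg_left hlog' (fareyDensity_nonneg n zero_le_one le_rfl)).trans
        (fareyDensity_one_mul_log_le n)
    have h6 : ((j : ℝ) + 2) * u ≤
        (j + 1) * fareyDensity n (1 / ((j : ℝ) + 2)) + fareyDensity n 1 := by
      have e1 : 1 / ((j : ℝ) + 1) / (1 + 1 / (j + 1)) = 1 / (j + 2) := by field_simp; ring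
      have e2 : 1 / (1 + 1 / ((j : ℝ) + 1)) = (j + 1) / (j + 2) := by field_simp; ring
      have hle : fareyDensity n (((j : ℝ) + 1) / (j + 2)) ≤ fareyDensity n 1 :=
        fareyDensity_mono n (by positivity) (by rw [div_le_one (by positivity)]; linarith) le_rfl
      have : ((j : ℝ) + 2) * u =
          (j + 1) * fareyDensity n (1 / ((j : ℝ) + 2)) + fareyDensity n ((j + 1) / (j + 2)) := by
        rw [hu, fareyDensity_succ, fareyTransfer, e1, e2]
        field_simp
        ring
      linarith
    push_cast
    rw [add_assoc, one_add_one_eq_two]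
    set v := fareyDensity n (1 / ((j : ℝ) + 2))
    set d := 1 / Real.log n with hd
    have hd0 : 0 < d := by positivity
    rw [div_eq_mul_one_div, ← hd] at h4 ⊢
    have h7 := mul_le_mul_of_nonneg_right h6 hlog.le
    have h8 := mul_le_mul_of_nonneg_left h4 (show 0 ≤ (j : ℝ) + 2 by positivity)
    have h9 : 0 ≤ j * ((C + 1) * d) := by positivity
    have h10 : 0 ≤ ((j : ℝ) + 1) * (v * Real.log n - (1 - 2 * (C + 1) * d)) := by linarith
    have := nonneg_of_mul_nonneg_right h10 (by positivity)
    linarith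

/-- Two-sided bound for the measure, with the logarithm taken at `n` and the density at `n - 1`. -/
theorem exists_volume_fareyPreimage_bounds {α β : ℝ} (hα : 0 < α) (hαβ : α ≤ β) (hβ : β ≤ 1) :
    ∃ C : ℝ, ∀ n : ℕ, 4 ≤ n →
      (volume : Measure unitInterval).real (fareyPreimage (n - 1) α β) * Real.log n
        ∈ Icc ((1 - C / Real.log n) * Real.log (β / α)) (Real.log (β / α)) := by
  obtain ⟨j, hj⟩ := exists_nat_one_div_lt hα
  obtain ⟨C, hC0, hC⟩ := exists_le_fareyDensity_mul_log j
  refine ⟨2 * C, fun n hn => ?_⟩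
  obtain ⟨k, rfl⟩ : ∃ k, n = k + 1 := ⟨n - 1, by omega⟩
  have hk3 : (3 : ℝ) ≤ k := by exact_mod_cast (show 3 ≤ k by omega)
  have hL : 0 ≤ Real.log (β / α) := Real.log_nonneg (by rwa [le_div_iff₀ hα, one_mul])
  have hlk : 0 < Real.log k := Real.log_pos (by linarith)
  have hlk' : Real.log k ≤ Real.log (k + 1) := Real.log_le_log (by linarith) (by linarith)
  have hl2 : Real.log (k + 1) ≤ 2 * Real.log k := by
    rw [two_mul, ← Real.log_mul (by positivity) (by positivity)]
    exact Real.log_le_log (by positivity) (by nlinarith)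
  have hj0 : (0 : ℝ) < 1 / ((j : ℝ) + 1) := by positivity
  have hV := integral_div_self_mem_Icc (continuousOn_fareyDensity k) hα hαβ hβ
    (m := fareyDensity k (1 / ((j : ℝ) + 1))) (M := fareyDensity k 1)
    (fun x hx => fareyDensity_mono k hj0.le (hj.le.trans hx.1) (hx.2.trans hβ))
    (fun x hx => fareyDensity_mono k (hα.le.trans hx.1) (hx.2.trans hβ) le_rfl)
  rw [Nat.add_sub_cancel, volume_fareyPreimage k hα hαβ hβ]
  push_cast
  constructor
  · refine le_trans ?_ (mul_le_mul_of_nonneg_right hV.1 (by linarith))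
    rw [mul_right_comm]
    refine mul_le_mul_of_nonneg_right ?_ hL
    have h1 := hC k (by exact_mod_cast (show (2 : ℝ) ≤ k by linarith))
    have h2 : C / Real.log k ≤ 2 * C / Real.log (k + 1) := by
      rw [div_le_div_iff₀ hlk (by linarith)]
      nlinarith
    have h3 := mul_le_mul_of_nonneg_left hlk' (fareyDensity_nonneg k hj0.le
      (hj.le.trans (hαβ.trans hβ)))
    linarith
  · refine (mul_le_mul_of_nonneg_right hV.2 (by linarith)).trans ?_
    rw [mul_right_comm]
    exact mul_le_of_le_one_left hL (fareyDensity_one_mul_log_le k)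

/-- `volume` on `unitInterval` is Lebesgue measure on `[0,1]`. -/
theorem theorem1 (α β : ℝ) (hα : 0 < α) (hαβ : α ≤ β) (hβ : β ≤ 1) :
    ∃ ε : ℕ → ℝ, ε =O[atTop] (fun n : ℕ => 1 / Real.log (n : ℝ)) ∧
      ∀ᶠ n : ℕ in atTop,
        (volume : Measure unitInterval).real (fareyPreimage (n - 1) α β)
          = Real.log (β / α) / Real.log (n : ℝ) * (1 + ε n) := by
  obtain ⟨C, hC⟩ := exists_volume_fareyPreimage_bounds hα hαβ hβ
  have hlog : ∀ n : ℕ, 4 ≤ n → 0 < Real.log n := fun n hn =>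
    Real.log_pos (by exact_mod_cast (show 1 < n by omega))
  rcases hαβ.eq_or_lt with rfl | hlt
  · -- a degenerate interval: both sides vanish
    refine ⟨0, isBigO_zero _ _, Eventually.of_forall fun n => ?_⟩
    rw [volume_fareyPreimage _ hα le_rfl hβ, intervalIntegral.integral_same, div_self hα.ne',
      Real.log_one, zero_div, zero_mul]
  · have hL : 0 < Real.log (β / α) := Real.log_pos (by rwa [lt_div_iff₀ hα, one_mul])
    refine ⟨fun n => (volume : Measure unitInterval).real (fareyPreimage (n - 1) α β)
      * Real.log n / Real.log (β / α) - 1, ?_, ?_⟩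
    · refine IsBigO.of_bound C ?_
      filter_upwards [eventually_ge_atTop 4] with n hn
      have hl := hlog n hn
      obtain ⟨h1, h2⟩ := hC n hn
      rw [← le_div_iff₀ hL] at h1
      rw [← div_le_one hL] at h2
      rw [Real.norm_of_nonpos (by linarith), Real.norm_of_nonneg (by positivity),
        ← div_eq_mul_one_div]
      linarith
    · filter_upwards [eventually_ge_atTop 4] with n hn
      have hl := hlog n hn
      field_simp
      ring
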